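/- **Setting.** Let $k\ge 0$ be an integer and let $b:\mathbb R\to\mathbb R$ be Lipschitz continuous and $1$-periodic. For $x\in\mathbb R$ let $t\mapsto y_x(t)$, $t\in\mathbb R$, be the solution of $\dot y=b(y)$, $y(0)=x$. Functions on $(0,1)$ are extended $1$-periodically, and $\|\cdot\|_{L^2}$, $(\cdot,\cdot)$ denote the norm and scalar product of $L^2(0,1)$ (real valued). For an integer $M\ge1$ let $\Delta x=1/M$, $I_i=(i\Delta x,(i+1)\Delta x)$ for $0\le i<M$, and let $V_k$ be the space of $v\in L^2(0,1)$ whose restriction to each $I_i$ is a polynomial of degree at most $k$. Let $x_\alpha\in(-1,1)$, $w_\alpha>0$ ($0\le\alpha\le k$) be the Gauss points and weights, i.e. $\int_{-1}^1p=\sum_{\alpha=0}^k w_\alpha p(x_\alpha)$ for every polynomial $p$ of degree at most $2k+1$. For $\Delta t>0$ let $x_{i,1}<\dots<x_{i,p_i}$ be the (finitely many) points $x\in I_i$ with $y_x(-\Delta t)\in \Delta x\,\mathbb Z$, and let $x_{i,0}=i\Delta x$, $x_{i,p_i+1}=(i+1)\Delta x$. Put $$(\varphi,\psi)_G=\sum_{i=0}^{M-1}\sum_{q=0}^{p_i}\sum_{\alpha=0}^k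 \tfrac{w_\alpha}{2}(x_{i,q+1}-x_{i,q})\,\varphi(\tilde x^i_{q,\alpha})\,\psi(\tilde x^i_{q,\alpha}),\qquad \tilde x^i_{q,\alpha}=x_{i,q}+\tfrac12(1+x_\alpha)(x_{i,q+1}-x_{i,q}).$$ For $u\in V_k$ let $\widetilde{\mathcal T}_{b,\Delta t}u$ be the unique element of $V_k$ such that $(\widetilde{\mathcal T}_{b,\Delta t}u,\varphi)=(u(y_\cdot(-\Delta t)),\varphi)_G$ for all $\varphi\in V_k$. **Proposition (Stability).** (i) For every $u\in L^2(0,1)$ and every $t\in\mathbb R$, the function $\tilde u(x):=u(y_x(-t))$ belongs to $L^2(0,1)$ and $$\|\tilde u\|_{L^2}\le e^{\frac12L|t|}\,\|u\|_{L^2},\qquad L:=\|b'\|_{L^\infty}.$$ (ii) If furthermore $b$ is of class $C^{2k+2}$, there is a constant $C_1\ge0$, depending only on $b$ and $k$ (in particular not on $\Delta x$ or $\Delta t$), such that for all $M\ge1$ and all $\Delta t>0$, $$\|\widetilde{\mathcal T}_{b,\Delta t}u\|_{L^2}\le e^{C_1\Delta t}\,\|u\|_{L^2}\qquad\text{for all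 }u\in V_k.$$ (iii) With the same $b$ and $C_1$ as in (ii), for all $M\ge1$, $\Delta t>0$ and every sequence in $V_k$ with $u^{n+1}=\widetilde{\mathcal T}_{b,\Delta t}u^n$, $$\|u^n\|_{L^2}\le e^{C_1t_n}\,\|u^0\|_{L^2}\qquad\text{for all }n\ge0,\quad t_n=n\Delta t.$$ -/

import Mathlib

namespace SLDG

open MeasureTheory Set Polynomial

/-! ### Gauss quadrature -/

/-- The Gauss quadrature rule with `k + 1` points on `(-1, 1)`: distinct points
`x_0, …, x_k ∈ (-1, 1)` and weights `w_α > 0` such that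
`∫_{-1}^1 p = ∑ α, w_α p(x_α)` for all polynomials `p` of degree at most `2 k + 1`.
Such a rule exists for every `k`, see `GaussRule.nonempty`; it is unique up to the order
of its points. -/
structure GaussRule (k : ℕ) where
  node : Fin (k + 1) → ℝ
  weight : Fin (k + 1) → ℝ
  node_injective : Function.Injective node
  node_mem : ∀ α, node α ∈ Ioo (-1 : ℝ) 1
  weight_pos : ∀ α, 0 < weight α
  exact : ∀ p : Polynomial ℝ, p.natDegree ≤ 2 * k + 1 →
    ∫ x in (-1 : ℝ)..1, p.eval x = ∑ α, weight α * p.eval (node α)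

theorem intervalIntegrable_eval (p : Polynomial ℝ) (a c : ℝ) :
    IntervalIntegrable (fun x => p.eval x) volume a c :=
  p.continuous.intervalIntegrable a c

/-- Integration over `[-1, 1]` as a linear functional on polynomials. -/
noncomputable def polyIntegral : Polynomial ℝ →ₗ[ℝ] ℝ where
  toFun p := ∫ x in (-1 : ℝ)..1, p.eval x
  map_add' p q := by
    simp only [eval_add]
    exact intervalIntegral.integral_add (intervalIntegrable_eval _ _ _)
      (intervalIntegrable_eval _ _ _)
  map_smul' c p := by simp [eval_smul]

theorem polyIntegral_pos {p : Polynomial ℝ} (hp : p ≠ 0)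
    (h : ∀ x ∈ Ioo (-1 : ℝ) 1, 0 ≤ p.eval x) : 0 < polyIntegral p := by
  have hc : ∀ x ∈ Icc (-1 : ℝ) 1, 0 ≤ p.eval x := by
    have : closure (Ioo (-1 : ℝ) 1) ⊆ {x | 0 ≤ p.eval x} :=
      closure_minimal h (isClosed_le continuous_const p.continuous)
    rwa [closure_Ioo (by norm_num)] at this
  refine intervalIntegral.integral_pos (by norm_num) p.continuous.continuousOn
    (fun x hx => hc x (Ioc_subset_Icc_self hx)) ?_
  by_contra! hcon
  refine hp (Polynomial.eq_zero_of_infinite_isRoot p ?_)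
  refine (Icc_infinite (show (-1 : ℝ) < 1 by norm_num)).mono fun x hx => ?_
  exact le_antisymm (hcon x hx) (hc x hx)

theorem exists_sign_change (n : ℕ) : ∀ p : Polynomial ℝ, p ≠ 0 → p.natDegree = n →
    ∃ S : Finset ℝ, (∀ r ∈ S, r ∈ Ioo (-1 : ℝ) 1 ∧ p.IsRoot r) ∧
      ((∀ x ∈ Ioo (-1 : ℝ) 1, 0 ≤ (p * ∏ r ∈ S, (X - C r)).eval x) ∨
       (∀ x ∈ Ioo (-1 : ℝ) 1, (p * ∏ r ∈ S, (X - C r)).eval x ≤ 0)) := by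
  induction n using Nat.strong_induction_on with
  | _ n ih =>
    intro p hp hn
    by_cases hr : ∃ r ∈ Ioo (-1 : ℝ) 1, p.IsRoot r
    · obtain ⟨r, hrI, hroot⟩ := hr
      obtain ⟨g, hg⟩ := dvd_iff_isRoot.mpr hroot
      have hg0 : g ≠ 0 := by rintro rfl; simp [hg] at hp
      have hdeg : p.natDegree = g.natDegree + 1 := by
        rw [hg, natDegree_mul (X_sub_C_ne_zero r) hg0, natDegree_X_sub_C, add_comm]
      obtain ⟨S, hS, hsign⟩ := ih g.natDegree (by omega) g hg0 rfl
      have hSp : ∀ s ∈ S, s ∈ Ioo (-1 : ℝ) 1 ∧ p.IsRoot s := fun s hs =>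
        ⟨(hS s hs).1, by rw [hg]; exact root_mul_left_of_isRoot _ (hS s hs).2⟩
      by_cases hrS : r ∈ S
      · refine ⟨S.erase r, fun s hs => hSp s (Finset.mem_of_mem_erase hs), ?_⟩
        have : p * ∏ s ∈ S.erase r, (X - C s) = g * ∏ s ∈ S, (X - C s) := by
          rw [← Finset.mul_prod_erase S _ hrS, hg]; ring
        rw [this]; exact hsign
      · refine ⟨insert r S, ?_, ?_⟩
        · intro s hs
          rcases Finset.mem_insert.mp hs with rfl | hs
          · exact ⟨hrI, hroot⟩
          · exact hSp s hs
        · have : ∀ x, (p * ∏ s ∈ insert r S, (X - C s)).eval x =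
              (x - r) ^ 2 * (g * ∏ s ∈ S, (X - C s)).eval x := by
            intro x
            rw [Finset.prod_insert hrS, hg]
            simp only [eval_mul, eval_sub, eval_X, eval_C]; ring
          simp only [this]
          rcases hsign with h | h
          · exact Or.inl fun x hx => mul_nonneg (sq_nonneg _) (h x hx)
          · exact Or.inr fun x hx => mul_nonpos_of_nonneg_of_nonpos (sq_nonneg _) (h x hx)
    · refine ⟨∅, by simp, ?_⟩
      push Not at hr
      simp only [Finset.prod_empty, mul_one]
      by_contra! hcon
      obtain ⟨⟨x, hx, hx'⟩, ⟨z, hz, hz'⟩⟩ := hcon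
      have hpc : IsPreconnected (Ioo (-1 : ℝ) 1) := isPreconnected_Ioo
      obtain ⟨c, hc, hc'⟩ := hpc.intermediate_value hx hz p.continuous.continuousOn
        (show (0 : ℝ) ∈ Icc _ _ from ⟨hx'.le, hz'.le⟩)
      exact hr c hc hc'

theorem exists_orthogonal (n : ℕ) : ∃ p : Polynomial ℝ, p ≠ 0 ∧ p.natDegree ≤ n ∧
    ∀ q : Polynomial ℝ, q.degree < n → polyIntegral (p * q) = 0 := by
  let B : degreeLT ℝ (n + 1) →ₗ[ℝ] Module.Dual ℝ (degreeLT ℝ n) :=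
    LinearMap.mk₂ ℝ (fun p q => polyIntegral (p.1 * q.1))
      (by intros; simp [add_mul]) (by intros; simp) (by intros; simp [mul_add]) (by intros; simp)
  have e1 : ∀ m, Module.finrank ℝ (degreeLT ℝ m) = m := fun m => by
    rw [(degreeLTEquiv ℝ m).finrank_eq, Module.finrank_fin_fun]
  have f1 : ∀ m, FiniteDimensional ℝ (degreeLT ℝ m) := fun m =>
    Module.Finite.equiv (degreeLTEquiv ℝ m).symm
  have hk := LinearMap.ker_ne_bot_of_finrank_lt (f := B)
    (by rw [Subspace.dual_finrank_eq, e1, e1]; omega)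
  obtain ⟨p, hpk, hp0⟩ := Submodule.exists_mem_ne_zero_of_ne_bot hk
  refine ⟨p.1, fun h => hp0 (Subtype.ext h), ?_, fun q hq => ?_⟩
  · have h2 : p.1 ∈ degreeLE ℝ n := by rw [← degreeLT_succ_eq_degreeLE]; exact p.2
    rw [mem_degreeLE] at h2
    exact natDegree_le_iff_degree_le.mpr h2
  · have := LinearMap.congr_fun (LinearMap.mem_ker.mp hpk) ⟨q, mem_degreeLT.mpr hq⟩
    simpa [B] using this

/-- For every `k` the Gauss rule with `k + 1` points exists. -/
theorem GaussRule.nonempty (k : ℕ) : Nonempty (GaussRule k) := by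
  obtain ⟨p, hp, hdeg, horth⟩ := exists_orthogonal (k + 1)
  obtain ⟨S, hS, hsign⟩ := exists_sign_change _ p hp rfl
  have hprod : (∏ r ∈ S, (X - C r)).Monic := monic_prod_of_monic _ _ fun r _ => monic_X_sub_C r
  have hpd : (∏ r ∈ S, (X - C r)).natDegree = S.card := by
    rw [natDegree_prod_of_monic _ _ fun r _ => monic_X_sub_C r]; simp
  have hne : p * ∏ r ∈ S, (X - C r) ≠ 0 := mul_ne_zero hp hprod.ne_zero
  have hge : k + 1 ≤ S.card := by
    by_contra! hlt
    have h0 := horth (∏ r ∈ S, (X - C r)) (by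
      rw [degree_eq_natDegree hprod.ne_zero, hpd]; exact_mod_cast hlt)
    rcases hsign with h | h
    · exact (polyIntegral_pos hne h).ne' h0
    · have := polyIntegral_pos (neg_ne_zero.mpr hne) (fun x hx => by
        rw [eval_neg]; linarith [h x hx])
      rw [map_neg, h0] at this; simp at this
  have hle : S.card ≤ p.natDegree := by
    refine (Finset.card_le_card (t := p.roots.toFinset) fun r hr => ?_).trans
      ((Multiset.toFinset_card_le _).trans (card_roots' p))
    simpa [hp] using (hS r hr).2
  have hcard : S.card = k + 1 := by omega
  have hpdeg : p.natDegree = k + 1 := by omega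
  let x : Fin (k + 1) → ℝ := S.orderEmbOfFin hcard
  have hxi : Function.Injective x := (S.orderEmbOfFin hcard).injective
  have hxS : ∀ α, x α ∈ S := fun α => S.orderEmbOfFin_mem hcard α
  let ℓ : Fin (k + 1) → Polynomial ℝ := fun α => Lagrange.basis Finset.univ x α
  have hex : ∀ f : Polynomial ℝ, f.natDegree ≤ 2 * k + 1 →
      polyIntegral f = ∑ α, polyIntegral (ℓ α) * f.eval (x α) := by
    intro f hf
    have hdm : f = p * (f / p) + f % p := (EuclideanDomain.div_add_mod f p).symm
    have hroot : ∀ α, (f % p).eval (x α) = f.eval (x α) := fun α => by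
      conv_rhs => rw [hdm]
      have : p.eval (x α) = 0 := (hS _ (hxS α)).2
      simp [this]
    have h1 : polyIntegral (p * (f / p)) = 0 := by
      refine horth _ ?_
      by_cases hq : f / p = 0
      · rw [hq, degree_zero]; exact WithBot.bot_lt_coe _
      have hpf : p.degree ≤ f.degree := by
        by_contra! hlt
        exact hq ((Polynomial.div_eq_zero_iff hp).mpr hlt)
      have hf0 : f ≠ 0 := by rintro rfl; simp at hq
      have := degree_add_div hp hpf
      rw [degree_eq_natDegree hp, degree_eq_natDegree hq, degree_eq_natDegree hf0, hpdeg] at this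
      rw [degree_eq_natDegree hq]
      norm_cast at this ⊢
      omega
    have hmd : (f % p).degree < (Finset.univ : Finset (Fin (k + 1))).card := by
      have := degree_mod_lt f hp
      rwa [degree_eq_natDegree hp, hpdeg, ← Finset.card_fin (k + 1)] at this
    have h2 := Lagrange.eq_interpolate (v := x) (s := Finset.univ) hxi.injOn hmd
    conv_lhs => rw [hdm, map_add, h1, zero_add, h2, Lagrange.interpolate_apply, map_sum]
    refine Finset.sum_congr rfl fun α _ => ?_
    rw [← smul_eq_C_mul, map_smul, smul_eq_mul, hroot, mul_comm]
  refine ⟨⟨x, fun α => polyIntegral (ℓ α), hxi, fun α => (hS _ (hxS α)).1, fun α => ?_, hex⟩⟩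
  have hl0 : ℓ α ≠ 0 := Lagrange.basis_ne_zero hxi.injOn (Finset.mem_univ α)
  have hl : (ℓ α).natDegree = k := by
    simpa using Lagrange.natDegree_basis (v := x) (s := Finset.univ) hxi.injOn (Finset.mem_univ α)
  have hsq := hex (ℓ α * ℓ α) (by rw [natDegree_mul hl0 hl0]; omega)
  rw [Finset.sum_eq_single α] at hsq
  · have h1 : (ℓ α).eval (x α) = 1 := Lagrange.eval_basis_self hxi.injOn (Finset.mem_univ α)
    rw [eval_mul, h1, mul_one, mul_one] at hsq
    rw [← hsq]
    exact polyIntegral_pos (mul_ne_zero hl0 hl0) fun z _ => by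
      rw [eval_mul]; exact mul_self_nonneg _
  · intro β _ hβ
    have h1 : (ℓ α).eval (x β) = 0 := Lagrange.eval_basis_of_ne hβ.symm (Finset.mem_univ β)
    rw [eval_mul, h1]; simp
  · simp
/-- The Gauss rule transported to the interval `(a, c)`. -/
noncomputable def GaussRule.quad {k : ℕ} (G : GaussRule k) (a c : ℝ) (f : ℝ → ℝ) : ℝ :=
  ∑ α, G.weight α / 2 * (c - a) * f (a + 1 / 2 * (1 + G.node α) * (c - a))

/-! ### Characteristics -/

theorem bounded_of_lipschitz_periodic {b : ℝ → ℝ} (hb : ∃ K, LipschitzWith K b)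
    (hper : Function.Periodic b 1) : ∃ B : NNReal, ∀ x, ‖b x‖ ≤ B := by
  obtain ⟨K, hK⟩ := hb
  obtain ⟨B, hB⟩ := (isCompact_Icc (a := (0 : ℝ)) (b := 1)).exists_bound_of_continuousOn
    hK.continuous.continuousOn
  refine ⟨B.toNNReal, fun x => ?_⟩
  obtain ⟨z, hz, hxz⟩ := hper.exists_mem_Ico₀ one_pos x
  rw [hxz]
  exact (hB z (Ico_subset_Icc_self hz)).trans (Real.le_coe_toNNReal B)

theorem exists_flow {b : ℝ → ℝ} (hb : ∃ K, LipschitzWith K b)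
    (hper : Function.Periodic b 1) (x : ℝ) :
    ∃ y : ℝ → ℝ, y 0 = x ∧ ∀ t, HasDerivAt y (b (y t)) t := by
  obtain ⟨B, hB⟩ := bounded_of_lipschitz_periodic hb hper
  obtain ⟨K, hK⟩ := hb
  have key : ∀ n : ℕ, ∃ y : ℝ → ℝ, y 0 = x ∧
      ∀ t ∈ Ioo (-(n + 1 : ℝ)) (n + 1), HasDerivAt y (b (y t)) t := by
    intro n
    have h0 : (0 : ℝ) ∈ Icc (-(n + 1 : ℝ)) (n + 1) := ⟨by linarith [n.cast_nonneg (α := ℝ)], by positivity⟩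
    have hpl : IsPicardLindelof (fun _ => b) (⟨0, h0⟩ : Icc (-(n + 1 : ℝ)) (n + 1)) x
        (B * (n + 1)) 0 B K :=
      IsPicardLindelof.of_time_independent (fun z _ => hB z) hK.lipschitzOnWith (by simp)
    obtain ⟨y, hy0, hy⟩ := hpl.exists_eq_forall_mem_Icc_hasDerivWithinAt₀
    exact ⟨y, hy0, fun t ht => (hy t (Ioo_subset_Icc_self ht)).hasDerivAt (Icc_mem_nhds ht.1 ht.2)⟩
  choose y hy0 hy using key
  have agree : ∀ m n : ℕ, m ≤ n → EqOn (y m) (y n) (Ioo (-(m + 1 : ℝ)) (m + 1)) := by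
    intro m n hmn
    have hmn' : (m : ℝ) ≤ n := by exact_mod_cast hmn
    refine ODE_solution_unique_of_mem_Ioo (v := fun _ => b) (s := fun _ => univ) (K := K)
      (t₀ := 0) (fun _ _ => hK.lipschitzOnWith) ⟨by linarith [m.cast_nonneg (α := ℝ)], by positivity⟩
      (fun t ht => ⟨hy m t ht, trivial⟩) (fun t ht => ⟨hy n t ⟨?_, ?_⟩, trivial⟩)
      (by rw [hy0, hy0])
    · linarith [ht.1]
    · linarith [ht.2]
  refine ⟨fun t => y ⌈|t|⌉₊ t, by simp [hy0], fun t => ?_⟩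
  set N := ⌈|t|⌉₊ + 1 with hN
  have hNt : |t| + 1 ≤ N := by rw [hN]; push_cast; linarith [Nat.le_ceil |t|]
  have hev : (fun s => y ⌈|s|⌉₊ s) =ᶠ[nhds t] y N := by
    filter_upwards [Ioo_mem_nhds (show t - 1 < t by linarith) (show t < t + 1 by linarith)] with s hs
    refine agree _ _ ?_ ?_
    · rw [Nat.ceil_le]
      have : |s| ≤ |t| + |s - t| := by have := abs_add_le t (s - t); simpa using this
      have : |s - t| < 1 := by rw [abs_lt]; constructor <;> linarith [hs.1, hs.2]
      linarith
    · have := Nat.le_ceil |s|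
      rw [mem_Ioo, ← abs_lt]; linarith
  have ht : t ∈ Ioo (-(N + 1 : ℝ)) (N + 1) := by rw [mem_Ioo, ← abs_lt]; linarith
  have := (hy N t ht).congr_of_eventuallyEq hev
  rwa [← hev.eq_of_nhds] at this

open Classical in
/-- The characteristic `y_x(t)`: the solution of `y' = b(y)` on `ℝ` with `y(0) = x`. It exists
(and is unique) when `b` is Lipschitz and periodic, see `charFlow_spec`; the value in the other
branch is a dummy. -/
noncomputable def charFlow (b : ℝ → ℝ) (x t : ℝ) : ℝ :=
  if h : ∃ y : ℝ → ℝ, y 0 = x ∧ ∀ s, HasDerivAt y (b (y s)) s then h.choose t else x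

theorem charFlow_spec {b : ℝ → ℝ} (hb : ∃ K, LipschitzWith K b) (hper : Function.Periodic b 1)
    (x : ℝ) : charFlow b x 0 = x ∧ ∀ t, HasDerivAt (charFlow b x) (b (charFlow b x t)) t := by
  have h := exists_flow hb hper x
  have he : charFlow b x = h.choose := by funext t; simp only [charFlow, dif_pos h]
  rw [he]; exact h.choose_spec

theorem charFlow_injective {b : ℝ → ℝ} (hb : ∃ K, LipschitzWith K b)
    (hper : Function.Periodic b 1) (t : ℝ) : Function.Injective fun x => charFlow b x t := by
  intro x z hxz
  have hx := charFlow_spec hb hper x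
  have hz := charFlow_spec hb hper z
  obtain ⟨K, hK⟩ := hb
  have := ODE_solution_unique_univ (v := fun _ => b) (s := fun _ => univ) (K := K) (t₀ := t)
    (fun _ => hK.lipschitzOnWith) (fun s => ⟨hx.2 s, trivial⟩) (fun s => ⟨hz.2 s, trivial⟩) hxz
  rw [← hx.1, ← hz.1, this]

/-- The points `x_{i,1}, …, x_{i,p_i}` of the open mesh cell `(i / M, (i + 1) / M)` whose backward
characteristic foot `y_x(-Δt)` is a point of the (periodically extended) mesh. -/
def breakSet (b : ℝ → ℝ) (Δt : ℝ) (M i : ℕ) : Set ℝ :=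
  {x | x ∈ Ioo (i / M : ℝ) ((i + 1) / M) ∧ ∃ ℓ : ℤ, charFlow b x (-Δt) = ℓ / M}

theorem breakSet_finite {b : ℝ → ℝ} (hb : ∃ K, LipschitzWith K b)
    (hper : Function.Periodic b 1) (Δt : ℝ) (M i : ℕ) : (breakSet b Δt M i).Finite := by
  obtain ⟨B, hB⟩ := bounded_of_lipschitz_periodic hb hper
  rcases Nat.eq_zero_or_pos M with rfl | hM
  · simp [breakSet]
  have hM' : (0 : ℝ) < M := by exact_mod_cast hM
  have hdisp : ∀ x, |charFlow b x (-Δt) - x| ≤ B * |Δt| := by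
    intro x
    have hx := charFlow_spec hb hper x
    have := convex_univ.norm_image_sub_le_of_norm_hasDerivWithin_le (f := charFlow b x)
      (fun t _ => (hx.2 t).hasDerivWithinAt) (fun t _ => hB _) (mem_univ 0) (mem_univ (-Δt))
    simpa [hx.1] using this
  refine Finite.of_finite_image (f := fun x => charFlow b x (-Δt)) ?_
    (charFlow_injective hb hper _).injOn
  refine Finite.subset (((finite_Icc (⌊(i : ℝ) - B * |Δt| * M⌋) (⌈(i + 1 : ℝ) + B * |Δt| * M⌉))).image
    (fun ℓ : ℤ => (ℓ / M : ℝ))) ?_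
  rintro _ ⟨x, ⟨⟨hx1, hx2⟩, ℓ, hℓ⟩, rfl⟩
  refine ⟨ℓ, ?_, hℓ.symm⟩
  have h := abs_le.mp (hdisp x)
  rw [hℓ] at h
  rw [div_lt_iff₀ hM'] at hx1
  rw [lt_div_iff₀ hM'] at hx2
  have e : (ℓ / M : ℝ) * M = ℓ := by field_simp
  constructor
  · have : (⌊(i : ℝ) - B * |Δt| * M⌋ : ℝ) ≤ ℓ := (Int.floor_le _).trans (by nlinarith [h.1])
    exact_mod_cast this
  · have : (ℓ : ℝ) ≤ ⌈(i + 1 : ℝ) + B * |Δt| * M⌉ := le_trans (by nlinarith [h.2]) (Int.le_ceil _)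
    exact_mod_cast this
open Classical in
/-- `breakSet` as a finite set (it is finite by `breakSet_finite`). -/
noncomputable def breaks (b : ℝ → ℝ) (Δt : ℝ) (M i : ℕ) : Finset ℝ :=
  if h : (breakSet b Δt M i).Finite then h.toFinset else ∅

/-- The points `x_{i,0} = i / M < x_{i,1} < ⋯ < x_{i,p_i} < x_{i,p_i+1} = (i + 1) / M` that cut
the mesh cell `i` into the intervals on which the transported function is regular. -/
noncomputable def subPt (b : ℝ → ℝ) (Δt : ℝ) (M i : ℕ) : ℕ → ℝ
  | 0 => i / M
  | q + 1 =>
    if h : q < (breaks b Δt M i).card then (breaks b Δt M i).orderEmbOfFin rfl ⟨q, h⟩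
    else (i + 1) / M

/-- The discrete form `(φ, ψ)_G`: the Gauss rule on each of the intervals
`(x_{i,q}, x_{i,q+1})`, `0 ≤ i < M`, `0 ≤ q ≤ p_i`. -/
noncomputable def gaussForm {k : ℕ} (G : GaussRule k) (b : ℝ → ℝ) (Δt : ℝ) (M : ℕ)
    (φ ψ : ℝ → ℝ) : ℝ :=
  ∑ i ∈ Finset.range M, ∑ q ∈ Finset.range ((breaks b Δt M i).card + 1),
    G.quad (subPt b Δt M i q) (subPt b Δt M i (q + 1)) fun x => φ x * ψ x

/-! ### The discontinuous Galerkin space and the scheme -/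

/-- The norm of `L²(0, 1)`. -/
noncomputable def l2norm (u : ℝ → ℝ) : ℝ :=
  (eLpNorm u 2 (volume.restrict (Ioo (0 : ℝ) 1))).toReal

/-- `L = ‖b'‖_{L^∞(0, 1)}`, the essential supremum of the almost everywhere defined `|b'|`. -/
noncomputable def derivBound (b : ℝ → ℝ) : ℝ :=
  (eLpNorm (deriv b) ⊤ (volume.restrict (Ioo (0 : ℝ) 1))).toReal

/-- The open mesh cell `I_i = (i / M, (i + 1) / M)`. -/
def cell (M i : ℕ) : Set ℝ := Ioo (i / M : ℝ) ((i + 1) / M)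

/-- The discontinuous Galerkin space `V_k` on the uniform mesh of `(0, 1)` with `M` cells, its
elements being extended to `ℝ` with period `1`. Each class in `L²(0, 1)` is represented by the
function that is a polynomial on every open cell and takes the value `0` at the mesh points. -/
def dgSpace (k M : ℕ) : Submodule ℝ (ℝ → ℝ) where
  carrier := {v | Function.Periodic v 1 ∧
    (∀ i < M, ∃ p : Polynomial ℝ, p.natDegree ≤ k ∧ ∀ x ∈ cell M i, v x = p.eval x) ∧
    ∀ x ∈ Ico (0 : ℝ) 1, (∀ i < M, x ∉ cell M i) → v x = 0}
  add_mem' := by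
    rintro u v ⟨hu1, hu2, hu3⟩ ⟨hv1, hv2, hv3⟩
    refine ⟨hu1.add hv1, fun i hi => ?_, fun x hx hn => ?_⟩
    · obtain ⟨p, hp, hpu⟩ := hu2 i hi
      obtain ⟨q, hq, hqv⟩ := hv2 i hi
      exact ⟨p + q, natDegree_add_le_of_degree_le hp hq, fun x hx => by
        simp [hpu x hx, hqv x hx]⟩
    · simp [hu3 x hx hn, hv3 x hx hn]
  zero_mem' := ⟨fun _ => rfl, fun _ _ => ⟨0, by simp, by simp⟩, fun _ _ _ => rfl⟩
  smul_mem' := by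
    rintro c v ⟨hv1, hv2, hv3⟩
    refine ⟨fun x => by simp [hv1 x], fun i hi => ?_, fun x hx hn => by simp [hv3 x hx hn]⟩
    obtain ⟨q, hq, hqv⟩ := hv2 i hi
    exact ⟨c • q, (natDegree_smul_le c q).trans hq, fun x hx => by simp [hqv x hx]⟩

theorem cell_subset {M i : ℕ} (hi : i < M) : cell M i ⊆ Ioo (0 : ℝ) 1 := by
  have hM : (0 : ℝ) < M := by exact_mod_cast (Nat.zero_le i).trans_lt hi
  have hi' : (i + 1 : ℝ) ≤ M := by exact_mod_cast hi
  exact Ioo_subset_Ioo (by positivity) ((div_le_one hM).mpr hi')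

theorem dgSpace_ext {k M : ℕ} {u v : dgSpace k M}
    (h : ∀ i < M, ∀ x ∈ cell M i, u.1 x = v.1 x) : u = v := by
  refine Subtype.ext (funext fun x => ?_)
  obtain ⟨z, hz, hxz⟩ := (u.2.1.sub v.2.1).exists_mem_Ico₀ one_pos x
  suffices hs : u.1 z = v.1 z by
    have : u.1 x - v.1 x = u.1 z - v.1 z := hxz
    linarith
  by_cases hc : ∃ i < M, z ∈ cell M i
  · obtain ⟨i, hi, hzi⟩ := hc
    exact h i hi z hzi
  · push Not at hc
    rw [u.2.2.2 z hz hc, v.2.2.2 z hz hc]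

theorem integrable_mul {k M : ℕ} (u v : dgSpace k M) :
    IntegrableOn (fun x => u.1 x * v.1 x) (Ioo (0 : ℝ) 1) := by
  have hmeas : MeasurableSet (⋃ i ∈ Finset.range M, cell M i) :=
    Finset.measurableSet_biUnion _ fun i _ => measurableSet_Ioo
  have h1 : IntegrableOn (fun x => u.1 x * v.1 x) (⋃ i ∈ Finset.range M, cell M i) := by
    rw [integrableOn_finset_iUnion]
    intro i hi
    obtain ⟨p, -, hp⟩ := u.2.2.1 i (Finset.mem_range.mp hi)
    obtain ⟨q, -, hq⟩ := v.2.2.1 i (Finset.mem_range.mp hi)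
    have : IntegrableOn (fun x => (p * q).eval x) (cell M i) :=
      ((p * q).continuous.integrableOn_Icc (a := (i / M : ℝ)) (b := (i + 1) / M)).mono_set
        Ioo_subset_Icc_self
    refine this.congr_fun (fun x hx => ?_) measurableSet_Ioo
    simp [hp x hx, hq x hx]
  have h2 : IntegrableOn (fun x => u.1 x * v.1 x)
      (Ioo (0 : ℝ) 1 \ ⋃ i ∈ Finset.range M, cell M i) := by
    refine (integrableOn_zero (ε' := ℝ)).congr_fun (fun x hx => ?_) (measurableSet_Ioo.diff hmeas)
    have : u.1 x = 0 := u.2.2.2 x (Ioo_subset_Ico_self hx.1) fun i hi hxi =>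
      hx.2 (mem_biUnion (Finset.mem_coe.mpr (Finset.mem_range.mpr hi)) hxi)
    simp [this]
  refine (h1.union h2).mono_set fun x hx => ?_
  by_cases hxc : x ∈ ⋃ i ∈ Finset.range M, cell M i
  · exact Or.inl hxc
  · exact Or.inr ⟨hx, hxc⟩

instance (k M : ℕ) : FiniteDimensional ℝ (dgSpace k M) := by
  let pt : Fin M → Fin (k + 1) → ℝ := fun i α => (i + (α + 1) / (k + 2)) / M
  let T : dgSpace k M →ₗ[ℝ] (Fin M → Fin (k + 1) → ℝ) :=
    { toFun := fun v i α => v.1 (pt i α)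
      map_add' := fun _ _ => rfl
      map_smul' := fun _ _ => rfl }
  refine Module.Finite.of_injective T ((injective_iff_map_eq_zero T).mpr fun v hv => ?_)
  refine dgSpace_ext fun i hi x hx => ?_
  have hM : (0 : ℝ) < M := by exact_mod_cast (Nat.zero_le i).trans_lt hi
  obtain ⟨p, hp, hpv⟩ := v.2.2.1 i hi
  have hk : (0 : ℝ) < k + 2 := by positivity
  have hinj : Function.Injective (pt ⟨i, hi⟩) := by
    intro α β hαβ
    simp only [pt] at hαβ
    rw [div_left_inj' hM.ne', add_right_inj, div_left_inj' hk.ne', add_left_inj] at hαβ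
    exact Fin.ext (by exact_mod_cast hαβ)
  have hmem : ∀ α, pt ⟨i, hi⟩ α ∈ cell M i := by
    intro α
    have h1 : (α : ℝ) + 1 < k + 2 := by
      have : (α : ℕ) + 1 < k + 2 := by omega
      exact_mod_cast this
    have h2 : ((α : ℝ) + 1) / (k + 2) < 1 := (div_lt_one hk).mpr h1
    have h3 : 0 < ((α : ℝ) + 1) / (k + 2) := by positivity
    exact ⟨div_lt_div_of_pos_right (by simpa using h3) hM,
      div_lt_div_of_pos_right (by simpa using h2) hM⟩
  have hp0 : p = 0 := by
    refine Polynomial.eq_zero_of_natDegree_lt_card_of_eval_eq_zero p hinj (fun α => ?_)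
      (by simpa using Nat.lt_succ_of_le hp)
    rw [← hpv _ (hmem α)]
    exact congrFun (congrFun hv ⟨i, hi⟩) α
  rw [hpv x hx, hp0]
  simp

/-- The scheme is well posed: there is exactly one `w ∈ V_k` with
`(w, φ) = (u(y_·(-Δt)), φ)_G` for all `φ ∈ V_k`. -/
theorem existsUnique_step {k : ℕ} (G : GaussRule k) (b : ℝ → ℝ) (Δt : ℝ) (M : ℕ) (u : ℝ → ℝ) :
    ∃! w : dgSpace k M, ∀ φ : dgSpace k M,
      ∫ x in Ioo (0 : ℝ) 1, w.1 x * φ.1 x =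
        gaussForm G b Δt M (fun x => u (charFlow b x (-Δt))) φ.1 := by
  let B : dgSpace k M →ₗ[ℝ] Module.Dual ℝ (dgSpace k M) :=
    LinearMap.mk₂ ℝ (fun v φ => ∫ x in Ioo (0 : ℝ) 1, v.1 x * φ.1 x)
      (fun v w φ => by
        rw [← integral_add (integrable_mul v φ) (integrable_mul w φ)]
        simp [add_mul])
      (fun c v φ => by
        rw [smul_eq_mul, ← integral_const_mul]
        simp [mul_assoc])
      (fun v φ ψ => by
        rw [← integral_add (integrable_mul v φ) (integrable_mul v ψ)]
        simp [mul_add])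
      (fun c v φ => by
        rw [smul_eq_mul, ← integral_const_mul]
        simp [mul_left_comm])
  let R : Module.Dual ℝ (dgSpace k M) :=
    { toFun := fun φ => gaussForm G b Δt M (fun x => u (charFlow b x (-Δt))) φ.1
      map_add' := fun φ ψ => by
        simp [gaussForm, GaussRule.quad, mul_add, Finset.sum_add_distrib]
      map_smul' := fun c φ => by
        simp [gaussForm, GaussRule.quad, Finset.mul_sum, mul_left_comm] }
  have hinj : Function.Injective B := by
    refine (injective_iff_map_eq_zero B).mpr fun v hv => ?_
    have h0 : ∫ x in Ioo (0 : ℝ) 1, v.1 x * v.1 x = 0 := LinearMap.congr_fun hv v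
    rw [integral_eq_zero_iff_of_nonneg (fun x => mul_self_nonneg _) (integrable_mul v v)] at h0
    refine dgSpace_ext fun i hi x hx => ?_
    obtain ⟨p, -, hp⟩ := v.2.2.1 i hi
    have h1 : (fun x => (p * p).eval x) =ᵐ[volume.restrict (cell M i)] fun _ => (0 : ℝ) := by
      filter_upwards [ae_restrict_of_ae_restrict_of_subset (cell_subset hi) h0,
        ae_restrict_mem measurableSet_Ioo] with z hz hzc
      have hz' : v.1 z * v.1 z = 0 := hz
      simpa [hp z hzc] using hz'
    have h2 := Measure.eqOn_open_of_ae_eq h1 isOpen_Ioo (p * p).continuous.continuousOn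
      continuousOn_const hx
    rw [hp x hx]
    simpa using h2
  have hsurj : Function.Surjective B :=
    (LinearMap.injective_iff_surjective_of_finrank_eq_finrank
      Subspace.dual_finrank_eq.symm).mp hinj
  obtain ⟨w, hw⟩ := hsurj R
  refine ⟨w, fun φ => LinearMap.congr_fun hw φ, fun z hz => hinj ?_⟩
  rw [hw]
  exact LinearMap.ext hz

/-- The operator of the scheme: `sldgOp G b Δt M u` is the unique element `w` of `V_k` such that
`(w, φ) = (u(y_·(-Δt)), φ)_G` for all `φ ∈ V_k`. -/
noncomputable def sldgOp {k : ℕ} (G : GaussRule k) (b : ℝ → ℝ) (Δt : ℝ) (M : ℕ)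
    (u : dgSpace k M) : dgSpace k M :=
  (existsUnique_step G b Δt M u.1).choose

theorem sldgOp_spec {k : ℕ} (G : GaussRule k) (b : ℝ → ℝ) (Δt : ℝ) (M : ℕ)
    (u φ : dgSpace k M) :
    ∫ x in Ioo (0 : ℝ) 1, (sldgOp G b Δt M u).1 x * φ.1 x =
      gaussForm G b Δt M (fun x => u.1 (charFlow b x (-Δt))) φ.1 :=
  (existsUnique_step G b Δt M u.1).choose_spec.1 φ

end SLDG

namespace SLDG

open MeasureTheory Set Polynomial

/-! ### The flow of a Lipschitz periodic field -/

section Flow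

variable {b : ℝ → ℝ}

/-! Both bounds rest on one fact: the time-`t` map of the flow is an increasing homeomorphism of the
line that commutes with translation by 1 and distorts lengths, in either direction, by at most `exp
(K * |t|)`, where `K` is any Lipschitz constant of `b`. Since `b` is the integral of its derivative,
`K = L` is allowed (`lipschitzWith_derivBound`).

For (i), the image of Lebesgue measure under the flow is at most `exp (L * |t|)` times Lebesgue
measure (`map_charFlow_le`). The unit interval is carried onto another interval of length one, over
which a periodic function has the same norm. The square root in the norm halves the exponent.

For (ii), let `w` be the new iterate and `f` the transported function. Testing the scheme with `w`
gives `‖w‖² = (f, w)_G ≤ ½ (f, f)_G + ½ (w, w)_G`. The Gauss rule is exact on `w²`, of degree at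
most `2k` on each piece, so `(w, w)_G = ‖w‖²` and hence `‖w‖² ≤ (f, f)_G` (`integral_sldgOp_sq_le`).
It remains to compare `(f, f)_G` with `‖u‖²`. On each subinterval `f` is one polynomial `p` composed
with the flow, so its Gauss sum is a quadrature of `p²` on the image interval whose nodes and length
are off by a relative `O(Δt)`. In the finite-dimensional space of polynomials of degree at most `k`
this costs a factor `exp (c * K * Δt)` only (`GaussRule.exists_quad_comp_le`), uniformly in the
length of the interval. The images tile one period, so the pieces add up to `‖u‖²`. Iterating the
one-step bound gives (iii). -/

theorem charFlow_zero (hb : ∃ K, LipschitzWith K b) (hper : Function.Periodic b 1) (x : ℝ) :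
    charFlow b x 0 = x :=
  (charFlow_spec hb hper x).1

theorem charFlow_eq_of_hasDerivAt (hb : ∃ K, LipschitzWith K b) (hper : Function.Periodic b 1)
    {y : ℝ → ℝ} (hy : ∀ t, HasDerivAt y (b (y t)) t) : charFlow b (y 0) = y := by
  have h := charFlow_spec hb hper (y 0)
  obtain ⟨K, hK⟩ := hb
  exact ODE_solution_unique_univ (v := fun _ => b) (s := fun _ => univ) (K := K) (t₀ := 0)
    (fun _ => hK.lipschitzOnWith) (fun s => ⟨h.2 s, trivial⟩) (fun s => ⟨hy s, trivial⟩) h.1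

theorem charFlow_charFlow (hb : ∃ K, LipschitzWith K b) (hper : Function.Periodic b 1)
    (x s t : ℝ) : charFlow b (charFlow b x s) t = charFlow b x (s + t) := by
  have h := charFlow_eq_of_hasDerivAt hb hper (y := fun r => charFlow b x (s + r))
    fun r => ((charFlow_spec hb hper x).2 (s + r)).comp_const_add s r
  simpa using congrFun h t

theorem charFlow_add_one (hb : ∃ K, LipschitzWith K b) (hper : Function.Periodic b 1)
    (x t : ℝ) : charFlow b (x + 1) t = charFlow b x t + 1 := by
  have h := charFlow_eq_of_hasDerivAt hb hper (y := fun r => charFlow b x r + 1)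
    fun r => by
      rw [hper]
      exact ((charFlow_spec hb hper x).2 r).add_const 1
  simpa [charFlow_zero hb hper] using congrFun h t

theorem charFlow_neg_charFlow (hb : ∃ K, LipschitzWith K b) (hper : Function.Periodic b 1)
    (t x : ℝ) : charFlow b (charFlow b x t) (-t) = x := by
  rw [charFlow_charFlow hb hper, add_neg_cancel, charFlow_zero hb hper]

theorem charFlow_charFlow_neg (hb : ∃ K, LipschitzWith K b) (hper : Function.Periodic b 1)
    (t x : ℝ) : charFlow b (charFlow b x (-t)) t = x := by
  rw [charFlow_charFlow hb hper, neg_add_cancel, charFlow_zero hb hper]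

/-- Grönwall's inequality. Negative times reduce to positive ones by reversing time, which replaces
`b` by `-b` and keeps the Lipschitz constant. -/
theorem dist_charFlow_le {K : NNReal} (hK : LipschitzWith K b) (hper : Function.Periodic b 1)
    (t x z : ℝ) : dist (charFlow b x t) (charFlow b z t) ≤ Real.exp (K * |t|) * dist x z := by
  have hd := fun x => (charFlow_spec ⟨K, hK⟩ hper x).2
  have h0 := charFlow_zero ⟨K, hK⟩ hper
  rcases le_total 0 t with ht | ht
  · have := dist_le_of_trajectories_ODE (v := fun _ => b) (a := 0) (b := t) (δ := dist x z)
      (fun _ => hK)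
      (fun s _ => (hd x s).continuousAt.continuousWithinAt) (fun s _ => (hd x s).hasDerivWithinAt)
      (fun s _ => (hd z s).continuousAt.continuousWithinAt) (fun s _ => (hd z s).hasDerivWithinAt)
      (by rw [h0, h0]) t ⟨ht, le_rfl⟩
    rwa [sub_zero, mul_comm, show K * t = K * |t| by rw [abs_of_nonneg ht]] at this
  · have hn : ∀ x s, HasDerivAt (fun r => charFlow b x (-r)) (-b (charFlow b x (-s))) s :=
      fun x s => by simpa [Function.comp_def] using (hd x (-s)).scomp s (hasDerivAt_neg s)
    have := dist_le_of_trajectories_ODE (v := fun _ => -b) (a := 0) (b := -t) (δ := dist x z)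
      (f := fun r => charFlow b x (-r)) (g := fun r => charFlow b z (-r))
      (fun _ => hK.neg)
      (fun s _ => (hn x s).continuousAt.continuousWithinAt) (fun s _ => (hn x s).hasDerivWithinAt)
      (fun s _ => (hn z s).continuousAt.continuousWithinAt) (fun s _ => (hn z s).hasDerivWithinAt)
      (by simp [h0]) (-t) ⟨by linarith, le_rfl⟩
    rwa [sub_zero, mul_comm, neg_neg, ← abs_of_nonpos ht] at this

theorem continuous_charFlow (hb : ∃ K, LipschitzWith K b) (hper : Function.Periodic b 1) (t : ℝ) :
    Continuous fun x => charFlow b x t := by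
  obtain ⟨K, hK⟩ := hb
  exact (LipschitzWith.of_dist_le_mul (K := (Real.exp (K * |t|)).toNNReal) fun x z => by
    rw [Real.coe_toNNReal _ (Real.exp_pos _).le]
    exact dist_charFlow_le hK hper t x z).continuous

/-- A continuous injection of the line is strictly monotone, and commuting with `x ↦ x + 1` rules
out the decreasing case. -/
theorem strictMono_charFlow (hb : ∃ K, LipschitzWith K b) (hper : Function.Periodic b 1) (t : ℝ) :
    StrictMono fun x => charFlow b x t := by
  refine ((continuous_charFlow hb hper t).strictMono_of_inj
    (charFlow_injective hb hper t)).resolve_right fun h => ?_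
  have h1 := h (zero_lt_one' ℝ)
  have h2 := charFlow_add_one hb hper 0 t
  simp only [zero_add] at h1 h2
  linarith

/-- The flow at time `t` as a homeomorphism of the line. -/
noncomputable def flowHomeomorph (hb : ∃ K, LipschitzWith K b) (hper : Function.Periodic b 1)
    (t : ℝ) : ℝ ≃ₜ ℝ where
  toFun x := charFlow b x t
  invFun x := charFlow b x (-t)
  left_inv := charFlow_neg_charFlow hb hper t
  right_inv := charFlow_charFlow_neg hb hper t
  continuous_toFun := continuous_charFlow hb hper t
  continuous_invFun := continuous_charFlow hb hper (-t)

theorem charFlow_sub_le {K : NNReal} (hK : LipschitzWith K b) (hper : Function.Periodic b 1)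
    (t : ℝ) {x z : ℝ} (hxz : x ≤ z) :
    charFlow b z t - charFlow b x t ≤ Real.exp (K * |t|) * (z - x) := by
  have := dist_charFlow_le hK hper t z x
  rw [Real.dist_eq, Real.dist_eq, abs_of_nonneg (sub_nonneg.mpr hxz)] at this
  exact (le_abs_self _).trans this

/-- The inverse of the flow is the flow at time `-t`, so this is the upper bound applied to the
inverse. -/
theorem le_charFlow_sub {K : NNReal} (hK : LipschitzWith K b) (hper : Function.Periodic b 1)
    (t : ℝ) {x z : ℝ} (hxz : x ≤ z) :
    z - x ≤ Real.exp (K * |t|) * (charFlow b z t - charFlow b x t) := by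
  have hb : ∃ K, LipschitzWith K b := ⟨K, hK⟩
  have := charFlow_sub_le hK hper (-t) ((strictMono_charFlow hb hper t).monotone hxz)
  simpa [charFlow_neg_charFlow hb hper] using this

end Flow

/-! ### The essential supremum of the derivative as a Lipschitz constant -/

/-- The integer translates of `(0, 1)` cover the line up to the integers, a null set. -/
theorem ae_of_ae_restrict_Ioo_of_periodic {P : ℝ → Prop} (hP : ∀ x, ∀ n : ℤ, P (x - n) → P x)
    (h : ∀ᵐ x ∂volume.restrict (Ioo (0 : ℝ) 1), P x) : ∀ᵐ x, P x := by
  rw [ae_restrict_iff' measurableSet_Ioo] at h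
  have h1 : ∀ᵐ x : ℝ, ∀ n : ℤ, x - n ∈ Ioo (0 : ℝ) 1 → P (x - n) :=
    ae_all_iff.mpr fun n =>
      (measurePreserving_sub_right volume (n : ℝ)).quasiMeasurePreserving.ae h
  have h2 : ∀ᵐ x : ℝ, x ∉ range ((↑) : ℤ → ℝ) :=
    (countable_range _).ae_notMem volume
  filter_upwards [h1, h2] with x hx hn
  refine hP x ⌊x⌋ (hx _ ⟨?_, by linarith [Int.lt_floor_add_one x]⟩)
  refine sub_pos.mpr (lt_of_le_of_ne (Int.floor_le x) fun he => hn ⟨_, he⟩)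

/-- A Lipschitz function is absolutely continuous, hence the integral of its derivative, and
periodicity spreads the essential bound from `(0, 1)` to the line. This lets the later estimates be
stated for an arbitrary Lipschitz constant. -/
theorem lipschitzWith_derivBound {b : ℝ → ℝ} (hb : ∃ K, LipschitzWith K b)
    (hper : Function.Periodic b 1) : LipschitzWith (derivBound b).toNNReal b := by
  obtain ⟨K, hK⟩ := hb
  have hfin : eLpNorm (deriv b) ⊤ (volume.restrict (Ioo (0 : ℝ) 1)) ≠ ⊤ := by
    refine ne_top_of_le_ne_top ENNReal.coe_ne_top (b := (K : ENNReal)) ?_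
    rw [eLpNorm_exponent_top]
    refine eLpNormEssSup_le_of_ae_nnnorm_bound (Filter.Eventually.of_forall fun x => ?_)
    exact_mod_cast norm_deriv_le_of_lipschitz hK
  have h1 : ∀ᵐ x ∂volume.restrict (Ioo (0 : ℝ) 1), ‖deriv b x‖ ≤ derivBound b := by
    rw [eLpNorm_exponent_top] at hfin
    filter_upwards [enorm_ae_le_eLpNormEssSup (deriv b) (volume.restrict (Ioo (0 : ℝ) 1))] with x hx
    have := ENNReal.toReal_mono hfin hx
    simpa [derivBound, eLpNorm_exponent_top] using this
  have hder : ∀ x, ∀ n : ℤ, deriv b (x - n) = deriv b x := by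
    intro x n
    have hn : (fun y => b (y - n)) = b := funext fun y => by
      simpa using hper.sub_int_mul_eq n (x := y)
    rw [← deriv_comp_sub_const, hn]
  have h2 := ae_of_ae_restrict_Ioo_of_periodic (fun x n h => by rwa [hder] at h) h1
  refine LipschitzWith.of_dist_le_mul fun x z => ?_
  have hac : AbsolutelyContinuousOnInterval b z x :=
    (hK.lipschitzOnWith (s := uIcc z x)).absolutelyContinuousOnInterval
  rw [Real.coe_toNNReal (derivBound b) ENNReal.toReal_nonneg, Real.dist_eq, Real.dist_eq,
    ← hac.integral_deriv_eq_sub]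
  exact intervalIntegral.norm_integral_le_of_norm_le_const_ae (h2.mono fun x hx _ => hx)

/-! ### Stability of transport in `L²` -/

/-- The preimage of a set under the flow is its image under the inverse flow. A Lipschitz map
enlarges one-dimensional Hausdorff measure, which is Lebesgue measure here, by at most its constant.
-/
theorem map_charFlow_le {b : ℝ → ℝ} {K : NNReal} (hK : LipschitzWith K b)
    (hper : Function.Periodic b 1) (t : ℝ) :
    Measure.map (fun x => charFlow b x t) volume ≤
      ENNReal.ofReal (Real.exp (K * |t|)) • (volume : Measure ℝ) := by
  have hb : ∃ K, LipschitzWith K b := ⟨K, hK⟩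
  refine Measure.le_iff.mpr fun s hs => ?_
  rw [Measure.map_apply (continuous_charFlow hb hper t).measurable hs]
  have hL : LipschitzWith (Real.exp (K * |t|)).toNNReal fun x => charFlow b x (-t) :=
    LipschitzWith.of_dist_le_mul fun x z => by
      rw [Real.coe_toNNReal _ (Real.exp_pos _).le]
      simpa using dist_charFlow_le hK hper (-t) x z
  have himg : (fun x => charFlow b x t) ⁻¹' s = (fun x => charFlow b x (-t)) '' s :=
    ((flowHomeomorph hb hper t).toEquiv.symm.image_eq_preimage_symm s).symm
  have := hL.hausdorffMeasure_image_le zero_le_one s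
  rw [hausdorffMeasure_real, ENNReal.rpow_one] at this
  rw [himg]
  exact this

theorem periodic_vadd {u : ℝ → ℝ} (hu : Function.Periodic u 1)
    (g : AddSubgroup.zmultiples (1 : ℝ)) (x : ℝ) : u (g +ᵥ x) = u x :=
  hu.map_vadd_zmultiples g x

/-- Any two half-open unit intervals are fundamental domains for the translations by integers. -/
theorem eLpNorm_periodic_Ioc {u : ℝ → ℝ} (hu : Function.Periodic u 1) (a c : ℝ) :
    eLpNorm u 2 (volume.restrict (Ioc a (a + 1))) =
      eLpNorm u 2 (volume.restrict (Ioc c (c + 1))) := by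
  rw [eLpNorm_eq_lintegral_rpow_enorm_toReal two_ne_zero ENNReal.ofNat_ne_top,
    eLpNorm_eq_lintegral_rpow_enorm_toReal two_ne_zero ENNReal.ofNat_ne_top]
  congr 1
  exact (isAddFundamentalDomain_Ioc one_pos a).setLIntegral_eq
    (isAddFundamentalDomain_Ioc one_pos c) 
    (fun x => ‖u x‖ₑ ^ (2 : ENNReal).toReal) fun g x => by rw [periodic_vadd hu]

theorem memLp_periodic_Ioc {u : ℝ → ℝ} (hu : Function.Periodic u 1) {a : ℝ} (c : ℝ)
    (h : MemLp u 2 (volume.restrict (Ioc a (a + 1)))) :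
    MemLp u 2 (volume.restrict (Ioc c (c + 1))) :=
  ⟨((isAddFundamentalDomain_Ioc one_pos a).aestronglyMeasurable_on_iff
    (isAddFundamentalDomain_Ioc one_pos c) (periodic_vadd hu)).mp h.1, by
    rw [eLpNorm_periodic_Ioc hu c a]; exact h.2⟩

theorem restrict_Ioo_eq : volume.restrict (Ioo (0 : ℝ) 1) = volume.restrict (Ioc (0 : ℝ) (0 + 1)) := by
  rw [zero_add]; exact Measure.restrict_congr_set Ioo_ae_eq_Ioc

theorem transport_L2 {b : ℝ → ℝ} {K : NNReal} (hK : LipschitzWith K b)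
    (hper : Function.Periodic b 1) {u : ℝ → ℝ} (hu : Function.Periodic u 1)
    (hmem : MemLp u 2 (volume.restrict (Ioo (0 : ℝ) 1))) (t : ℝ) :
    MemLp (fun x => u (charFlow b x t)) 2 (volume.restrict (Ioo (0 : ℝ) 1)) ∧
      l2norm (fun x => u (charFlow b x t)) ≤ Real.exp (1 / 2 * K * |t|) * l2norm u := by
  have hb : ∃ K, LipschitzWith K b := ⟨K, hK⟩
  set Φ : ℝ → ℝ := fun x => charFlow b x t with hΦ
  have hemb : MeasurableEmbedding Φ := (flowHomeomorph hb hper t).measurableEmbedding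
  have hmono : StrictMono Φ := strictMono_charFlow hb hper t
  have hpre : Φ ⁻¹' Ioc (Φ 0) (Φ 0 + 1) = Ioc 0 (0 + 1) := by
    have h1 : Φ 0 + 1 = Φ (0 + 1) := (charFlow_add_one hb hper 0 t).symm
    ext x
    rw [h1, mem_preimage, mem_Ioc, mem_Ioc, hmono.lt_iff_lt, hmono.le_iff_le]
  -- Half-open intervals make one period go exactly onto one period, so the global bound on the
  -- image measure restricts.
  have hmap : Measure.map Φ (volume.restrict (Ioo (0 : ℝ) 1)) ≤
      ENNReal.ofReal (Real.exp (K * |t|)) • volume.restrict (Ioc (Φ 0) (Φ 0 + 1)) := by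
    rw [restrict_Ioo_eq, ← hpre, ← hemb.restrict_map, ← Measure.restrict_smul]
    exact Measure.restrict_mono_measure (map_charFlow_le hK hper t) _
  have hmem' := memLp_periodic_Ioc hu (Φ 0) (restrict_Ioo_eq ▸ hmem)
  have h1 : MemLp (u ∘ Φ) 2 (volume.restrict (Ioo (0 : ℝ) 1)) :=
    hemb.memLp_map_measure_iff.mp
      ((hmem'.smul_measure ENNReal.ofReal_ne_top).mono_measure hmap)
  refine ⟨h1, ?_⟩
  have h2 := eLpNorm_mono_measure (p := 2) u hmap
  rw [hemb.eLpNorm_map_measure, eLpNorm_smul_measure_of_ne_top ENNReal.ofNat_ne_top,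
    eLpNorm_periodic_Ioc hu (Φ 0) 0, ← restrict_Ioo_eq,
    ENNReal.ofReal_rpow_of_pos (Real.exp_pos _), ← Real.exp_mul] at h2
  have h3 := ENNReal.toReal_mono (ENNReal.mul_ne_top ENNReal.ofReal_ne_top hmem.2.ne) h2
  rw [ENNReal.toReal_mul, ENNReal.toReal_ofReal (Real.exp_pos _).le] at h3
  have he : (K : ℝ) * |t| * (1 / 2 : ENNReal).toReal = 1 / 2 * K * |t| := by
    simp; ring
  rw [he] at h3
  exact h3

/-! ### Gauss quadrature at perturbed nodes -/

theorem GaussRule.quad_eval {k : ℕ} (G : GaussRule k) (a d : ℝ) {p : Polynomial ℝ}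
    (hp : p.natDegree ≤ 2 * k + 1) : G.quad a d (fun x => p.eval x) = ∫ x in a..d, p.eval x := by
  have hdeg : (p.comp (C ((a + d) / 2) + C ((d - a) / 2) * X)).natDegree ≤ 2 * k + 1 := by
    refine natDegree_comp_le.trans ?_
    have : (C ((a + d) / 2) + C ((d - a) / 2) * X).natDegree ≤ 1 := by
      rw [add_comm]; exact natDegree_linear_le
    nlinarith
  have h := G.exact _ hdeg
  have h2 := intervalIntegral.mul_integral_comp_add_mul (f := fun x => p.eval x) (a := -1) (b := 1)
    ((d - a) / 2) ((a + d) / 2)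
  rw [show (a + d) / 2 + (d - a) / 2 * -1 = a by ring,
    show (a + d) / 2 + (d - a) / 2 * 1 = d by ring] at h2
  simp only [eval_comp, eval_add, eval_mul, eval_C, eval_X] at h
  rw [← h2, h, Finset.mul_sum, GaussRule.quad]
  refine Finset.sum_congr rfl fun α _ => ?_
  rw [show a + 1 / 2 * (1 + G.node α) * (d - a) = (a + d) / 2 + (d - a) / 2 * G.node α by ring]
  ring

theorem exists_abs_eval_sub_le (p : Polynomial ℝ) :
    ∃ c : ℝ, 0 ≤ c ∧ ∀ s ∈ Icc (-1 : ℝ) 1, ∀ t ∈ Icc (-1 : ℝ) 1,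
      |p.eval s - p.eval t| ≤ c * |s - t| := by
  obtain ⟨c, hc⟩ := (isCompact_Icc (a := (-1 : ℝ)) (b := 1)).exists_bound_of_continuousOn
    p.derivative.continuous.continuousOn
  refine ⟨c, (norm_nonneg _).trans (hc 0 (by norm_num)), fun s hs t ht => ?_⟩
  exact (convex_Icc (-1 : ℝ) 1).norm_image_sub_le_of_norm_hasDerivWithin_le
    (fun x _ => (p.hasDerivAt x).hasDerivWithinAt) hc ht hs

/-- Lagrange interpolation: `k + 1` nodes determine a polynomial of degree at most `k`. This turns
bounds at the nodes into bounds everywhere. -/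
theorem GaussRule.eval_eq_sum {k : ℕ} (G : GaussRule k) {q : Polynomial ℝ}
    (hq : q.natDegree ≤ k) (s : ℝ) :
    q.eval s = ∑ α, q.eval (G.node α) * (Lagrange.basis Finset.univ G.node α).eval s := by
  have hd : q.degree < (Finset.univ : Finset (Fin (k + 1))).card := by
    rw [Finset.card_fin]
    exact (degree_le_of_natDegree_le hq).trans_lt (by exact_mod_cast Nat.lt_succ_self k)
  have h := congrArg (Polynomial.eval s)
    (Lagrange.eq_interpolate (v := G.node) G.node_injective.injOn hd)
  rw [h, Lagrange.interpolate_apply, eval_finsetSum]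
  simp only [eval_mul, eval_C]

/-- Moving the Gauss nodes by at most `ε` inside `[-1, 1]` changes the discrete norm of a
polynomial of degree at most `k` by a factor `1 + O(ε)`. -/
theorem GaussRule.exists_sum_sq_le {k : ℕ} (G : GaussRule k) :
    ∃ c : ℕ, ∀ q : Polynomial ℝ, q.natDegree ≤ k → ∀ (s : Fin (k + 1) → ℝ) (ε : ℝ),
      (∀ α, s α ∈ Icc (-1 : ℝ) 1) → (∀ α, |s α - G.node α| ≤ ε) →
      ∑ α, G.weight α * q.eval (s α) ^ 2 ≤
        (1 + c * ε) * ∑ α, G.weight α * q.eval (G.node α) ^ 2 := by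
  set ℓ := fun α => Lagrange.basis Finset.univ G.node α
  choose A hA0 hA using fun α β => exists_abs_eval_sub_le (ℓ α * ℓ β)
  -- `q²` is a quadratic form in the nodal values of `q`, with coefficients `ℓ α * ℓ β` of Lipschitz
  -- constant `A α β`. Each nodal value squared is at most `N / weight`, and the mean of the two
  -- reciprocals comes from bounding a product of nodal values by half the sum of squares.
  set D := ∑ α, ∑ β, A α β * ((1 / G.weight α + 1 / G.weight β) / 2)
  -- Rounded up to a natural number so that Bernoulli's inequality can later turn `1 + c * ε` into a
  -- power.
  refine ⟨⌈(∑ α, G.weight α) * D⌉₊, fun q hq s ε hs hε => ?_⟩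
  set N := ∑ α, G.weight α * q.eval (G.node α) ^ 2
  have hN0 : 0 ≤ N := Finset.sum_nonneg fun α _ => mul_nonneg (G.weight_pos α).le (sq_nonneg _)
  have hε0 : 0 ≤ ε := (abs_nonneg _).trans (hε 0)
  have hqN : ∀ α, q.eval (G.node α) ^ 2 ≤ 1 / G.weight α * N := by
    intro α
    have : G.weight α * q.eval (G.node α) ^ 2 ≤ N :=
      Finset.single_le_sum (f := fun α => G.weight α * q.eval (G.node α) ^ 2)
        (fun α _ => mul_nonneg (G.weight_pos α).le (sq_nonneg _)) (Finset.mem_univ α)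
    rw [one_div, inv_mul_eq_div, le_div_iff₀ (G.weight_pos α)]
    linarith
  have hexp : ∀ r, q.eval r ^ 2 =
      ∑ α, ∑ β, q.eval (G.node α) * q.eval (G.node β) * (ℓ α * ℓ β).eval r := by
    intro r
    rw [sq, G.eval_eq_sum hq r, Finset.sum_mul_sum]
    refine Finset.sum_congr rfl fun α _ => Finset.sum_congr rfl fun β _ => ?_
    rw [eval_mul]; ring
  have hdiff : ∀ α, q.eval (s α) ^ 2 - q.eval (G.node α) ^ 2 ≤ D * N * ε := by
    intro γ
    rw [hexp, hexp, ← Finset.sum_sub_distrib, mul_assoc, Finset.sum_mul]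
    refine Finset.sum_le_sum fun α _ => ?_
    rw [← Finset.sum_sub_distrib, Finset.sum_mul]
    refine Finset.sum_le_sum fun β _ => ?_
    rw [← mul_sub]
    refine (le_abs_self _).trans ?_
    rw [abs_mul]
    have h1 : |(ℓ α * ℓ β).eval (s γ) - (ℓ α * ℓ β).eval (G.node γ)| ≤ A α β * ε :=
      (hA α β _ (hs γ) _ (Ioo_subset_Icc_self (G.node_mem γ))).trans
        (mul_le_mul_of_nonneg_left (hε γ) (hA0 α β))
    have h2 : |q.eval (G.node α) * q.eval (G.node β)| ≤
        (1 / G.weight α + 1 / G.weight β) / 2 * N := by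
      have hα := hqN α
      have hβ := hqN β
      rw [abs_le]
      constructor
      · nlinarith [sq_nonneg (q.eval (G.node α) + q.eval (G.node β))]
      · nlinarith [sq_nonneg (q.eval (G.node α) - q.eval (G.node β))]
    refine (mul_le_mul h2 h1 (abs_nonneg _) ((abs_nonneg _).trans h2)).trans_eq ?_
    ring
  have hsum : ∑ α, G.weight α * q.eval (s α) ^ 2 ≤ N + (∑ α, G.weight α) * D * (ε * N) := by
    rw [mul_assoc, Finset.sum_mul, ← Finset.sum_add_distrib]
    refine Finset.sum_le_sum fun α _ => ?_
    have := mul_le_mul_of_nonneg_left (hdiff α) (G.weight_pos α).le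
    nlinarith
  have := mul_le_mul_of_nonneg_right (Nat.le_ceil ((∑ α, G.weight α) * D)) (mul_nonneg hε0 hN0)
  nlinarith

/-- Rescaling `[a, d]` and `[f a, f d]` to `[-1, 1]` removes all dependence on their lengths; only
the distortion `E` of `f` remains. The exponent is a power of `E`, not a bound on `E - 1`, so that
`E = exp (K * |Δt|)` gives an exponential for every time step, small or not. -/
theorem GaussRule.exists_quad_comp_le {k : ℕ} (G : GaussRule k) :
    ∃ c : ℕ, ∀ p : Polynomial ℝ, p.natDegree ≤ k → ∀ (f : ℝ → ℝ) (E a d : ℝ), a < d →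
      (∀ x z, x ≤ z → f z - f x ≤ E * (z - x)) → (∀ x z, x ≤ z → z - x ≤ E * (f z - f x)) →
      StrictMono f → 1 ≤ E →
      G.quad a d (fun x => p.eval (f x) ^ 2) ≤ E ^ c * ∫ x in f a..f d, p.eval x ^ 2 := by
  obtain ⟨c, hc⟩ := G.exists_sum_sq_le
  -- `4c` pays for the displaced nodes, the last factor `E` for the ratio of the lengths.
  refine ⟨2 * (2 * c) + 1, fun p hp f E a d had hup hlow hf hE => ?_⟩
  set H := f d - f a with hH
  have hH0 : 0 < H := sub_pos.mpr (hf had)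
  set h := d - a with hh
  have hh0 : 0 < h := sub_pos.mpr had
  set q := p.comp (C (f a + H / 2) + C (H / 2) * X) with hq
  have hqe : ∀ s, q.eval s = p.eval (f a + 1 / 2 * (1 + s) * H) := by
    intro s
    simp only [hq, eval_comp, eval_add, eval_mul, eval_C, eval_X]
    congr 1; ring
  have hlin : (C (f a + H / 2) + C (H / 2) * X).natDegree ≤ 1 := by
    rw [add_comm]; exact natDegree_linear_le
  have hqd : q.natDegree ≤ k := natDegree_comp_le.trans (by nlinarith)
  set x : Fin (k + 1) → ℝ := fun α => a + 1 / 2 * (1 + G.node α) * h with hx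
  -- The images of the Gauss nodes of `[a, d]`, rescaled from `[f a, f d]` to `[-1, 1]`.
  set s : Fin (k + 1) → ℝ := fun α => 2 * ((f (x α) - f a) / H) - 1 with hs
  have hqs : ∀ α, q.eval (s α) = p.eval (f (x α)) := by
    intro α
    rw [hqe]
    congr 1
    simp only [hs]
    field_simp
    ring
  have hxa : ∀ α, a ≤ x α := fun α => by
    have := (G.node_mem α).1
    simp only [hx]
    nlinarith
  have hxd : ∀ α, x α ≤ d := fun α => by
    have := (G.node_mem α).2
    simp only [hx]
    nlinarith
  have hsI : ∀ α, s α ∈ Icc (-1 : ℝ) 1 := by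
    intro α
    have h1 : 0 ≤ (f (x α) - f a) / H :=
      div_nonneg (sub_nonneg.mpr (hf.monotone (hxa α))) hH0.le
    have h2 : (f (x α) - f a) / H ≤ 1 := by
      rw [div_le_one hH0]
      linarith [hf.monotone (hxd α)]
    constructor <;> simp only [hs] <;> linarith
  have hhH : h ≤ E * H := hlow a d had.le
  -- The relative distance of an image node from either end of `[f a, f d]` is at most `E²` times
  -- the original one: one factor `E` from stretching, one from the total length. The bound at the
  -- left end limits the displacement to the right, and conversely.
  have hsn : ∀ α, |s α - G.node α| ≤ 2 * (E ^ 2 - 1) := by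
    intro α
    obtain ⟨hn1, hn2⟩ := G.node_mem α
    have hr0 : 0 ≤ (1 + G.node α) / 2 := by linarith
    have hr1 : 0 ≤ 1 - (1 + G.node α) / 2 := by linarith
    have hEE : 1 ≤ E ^ 2 := one_le_pow₀ hE
    have key : ∀ r y : ℝ, 0 ≤ r → y ≤ E * (r * h) → y / H ≤ E ^ 2 * r := by
      intro r y hr hy
      rw [div_le_iff₀ hH0]
      have := mul_le_mul_of_nonneg_left hhH (mul_nonneg (zero_le_one.trans hE) hr)
      nlinarith
    have h1 := key _ (f (x α) - f a) hr0
      ((hup a (x α) (hxa α)).trans_eq (by simp only [hx]; ring))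
    have h2 := key _ (f d - f (x α)) hr1
      ((hup (x α) d (hxd α)).trans_eq (by simp only [hx, hh]; ring))
    have h3 : (f d - f (x α)) / H = 1 - (f (x α) - f a) / H := by
      rw [eq_sub_iff_add_eq, ← add_div, sub_add_sub_cancel, div_self hH0.ne']
    rw [h3] at h2
    rw [abs_le]
    constructor <;> simp only [hs] <;> nlinarith
  have hmain := hc q hqd s _ hsI hsn
  simp only [hqs] at hmain
  set N := ∑ α, G.weight α * q.eval (G.node α) ^ 2
  have hN0 : 0 ≤ N := Finset.sum_nonneg fun α _ => mul_nonneg (G.weight_pos α).le (sq_nonneg _)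
  have hint : ∫ y in f a..f d, p.eval y ^ 2 = H / 2 * N := by
    have := G.quad_eval (f a) (f d) (p := p ^ 2) (by
      refine natDegree_pow_le.trans ?_
      omega)
    simp only [eval_pow] at this
    rw [← this, GaussRule.quad, Finset.mul_sum]
    refine Finset.sum_congr rfl fun α _ => ?_
    rw [hqe]; ring
  have hquad : G.quad a d (fun y => p.eval (f y) ^ 2) =
      h / 2 * ∑ α, G.weight α * p.eval (f (x α)) ^ 2 := by
    rw [GaussRule.quad, Finset.mul_sum]
    refine Finset.sum_congr rfl fun α _ => ?_
    ring
  -- Bernoulli's inequality for `(1 + (E² - 1)) ^ (2c)`.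
  have hbern : 1 + c * (2 * (E ^ 2 - 1)) ≤ E ^ (2 * (2 * c)) := by
    have := one_add_mul_le_pow (a := E ^ 2 - 1) (by nlinarith) (2 * c)
    rw [pow_mul]
    refine le_trans (le_of_eq ?_) (this.trans_eq ?_)
    · push_cast; ring
    · congr 1; ring
  rw [hquad, hint]
  calc h / 2 * ∑ α, G.weight α * p.eval (f (x α)) ^ 2
      ≤ (E * H) / 2 * (E ^ (2 * (2 * c)) * N) := by
        have := hmain.trans (mul_le_mul_of_nonneg_right hbern hN0)
        refine mul_le_mul (by linarith) this
          (Finset.sum_nonneg fun α _ => mul_nonneg (G.weight_pos α).le (sq_nonneg _)) ?_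
        have := hh0.le.trans hhH
        linarith
    _ = E ^ (2 * (2 * c) + 1) * (H / 2 * N) := by ring

/-! ### The subdivision of a mesh cell -/

section Subdivision

variable {b : ℝ → ℝ} {Δt : ℝ} {M i : ℕ}

theorem mem_breaks (hb : ∃ K, LipschitzWith K b) (hper : Function.Periodic b 1) {x : ℝ} :
    x ∈ breaks b Δt M i ↔ x ∈ breakSet b Δt M i := by
  rw [breaks, dif_pos (breakSet_finite hb hper Δt M i), Finite.mem_toFinset]

theorem breaks_subset {x : ℝ} (hx : x ∈ breaks b Δt M i) : x ∈ Ioo (i / M : ℝ) ((i + 1) / M) := by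
  rw [breaks] at hx
  split_ifs at hx with h
  · exact (h.mem_toFinset.mp hx).1
  · simp at hx

theorem subPt_succ_of_lt {q : ℕ} (h : q < (breaks b Δt M i).card) :
    subPt b Δt M i (q + 1) = (breaks b Δt M i).orderEmbOfFin rfl ⟨q, h⟩ := by
  rw [subPt, dif_pos h]

theorem subPt_card_succ :
    subPt b Δt M i ((breaks b Δt M i).card + 1) = (i + 1) / M := by
  rw [subPt, dif_neg (lt_irrefl _)]

theorem subPt_lt_succ (hM : 1 ≤ M) {q : ℕ} (hq : q ≤ (breaks b Δt M i).card) :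
    subPt b Δt M i q < subPt b Δt M i (q + 1) := by
  have hM' : (0 : ℝ) < M := by exact_mod_cast hM
  have hmem : ∀ r (h : r < (breaks b Δt M i).card),
      subPt b Δt M i (r + 1) ∈ Ioo (i / M : ℝ) ((i + 1) / M) := fun r h => by
    rw [subPt_succ_of_lt h]
    exact breaks_subset (Finset.orderEmbOfFin_mem _ _ _)
  rcases hq.eq_or_lt with rfl | hq
  · rw [subPt_card_succ]
    rcases h : (breaks b Δt M i).card with _ | r
    · rw [subPt]
      exact div_lt_div_of_pos_right (by linarith) hM'
    · exact (hmem r (by omega)).2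
  · cases q with
    | zero => exact (hmem 0 hq).1
    | succ r =>
      rw [subPt_succ_of_lt hq, subPt_succ_of_lt ((Nat.lt_succ_self r).trans hq)]
      exact (OrderEmbedding.lt_iff_lt _).mpr (by simp)

theorem subPt_le_subPt (hM : 1 ≤ M) {q r : ℕ} (hqr : q ≤ r)
    (hr : r ≤ (breaks b Δt M i).card + 1) : subPt b Δt M i q ≤ subPt b Δt M i r := by
  induction r, hqr using Nat.le_induction with
  | base => exact le_rfl
  | succ r _ ih => exact (ih (by omega)).trans (subPt_lt_succ hM (by omega)).le

theorem subPt_mem_Icc (hM : 1 ≤ M) {q : ℕ} (hq : q ≤ (breaks b Δt M i).card + 1) :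
    subPt b Δt M i q ∈ Icc (i / M : ℝ) ((i + 1) / M) := by
  rw [← subPt_card_succ (b := b) (Δt := Δt)]
  exact ⟨subPt_le_subPt hM (Nat.zero_le q) hq, subPt_le_subPt hM hq le_rfl⟩

theorem notMem_breaks_of_mem_Ioo (hM : 1 ≤ M) {q : ℕ} (hq : q ≤ (breaks b Δt M i).card) {x : ℝ}
    (hx : x ∈ Ioo (subPt b Δt M i q) (subPt b Δt M i (q + 1))) : x ∉ breaks b Δt M i := by
  intro hxb
  have hr : x ∈ range ((breaks b Δt M i).orderEmbOfFin rfl) := by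
    rw [Finset.range_orderEmbOfFin]; exact hxb
  obtain ⟨⟨r, hr⟩, rfl⟩ := hr
  rw [← subPt_succ_of_lt hr] at hx
  rcases Nat.lt_or_ge r q with h | h
  · exact hx.1.not_ge (subPt_le_subPt hM h (by omega))
  · exact hx.2.not_ge (subPt_le_subPt hM (by omega) (by omega))

/-- The backward characteristics carry each interval of the subdivision into one mesh cell. -/
theorem exists_cell_charFlow (hb : ∃ K, LipschitzWith K b) (hper : Function.Periodic b 1)
    (hM : 1 ≤ M) {q : ℕ} (hq : q ≤ (breaks b Δt M i).card) :
    ∃ j : ℤ, (j / M : ℝ) ≤ charFlow b (subPt b Δt M i q) (-Δt) ∧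
      charFlow b (subPt b Δt M i (q + 1)) (-Δt) ≤ (j + 1) / M := by
  have hM' : (0 : ℝ) < M := by exact_mod_cast hM
  set y := charFlow b (subPt b Δt M i q) (-Δt)
  refine ⟨⌊y * M⌋, ?_, ?_⟩
  · rw [div_le_iff₀ hM']; exact Int.floor_le _
  -- Otherwise the image would contain the next mesh point in its interior, and the preimage of that
  -- point would be a break strictly between two consecutive ones.
  · by_contra! hlt
    have h1 : y < (⌊y * M⌋ + 1) / M := by
      rw [lt_div_iff₀ hM']; exact Int.lt_floor_add_one _
    obtain ⟨x, hx, hxe⟩ := intermediate_value_Ioo (subPt_lt_succ hM hq).le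
      (continuous_charFlow hb hper (-Δt)).continuousOn ⟨h1, hlt⟩
    refine notMem_breaks_of_mem_Ioo hM hq hx ((mem_breaks hb hper).mpr ⟨⟨?_, ?_⟩, ⌊y * M⌋ + 1, ?_⟩)
    · exact (subPt_mem_Icc hM (by omega)).1.trans_lt hx.1
    · exact hx.2.trans_le (subPt_mem_Icc hM (by omega)).2
    · push_cast; exact hxe

end Subdivision

/-! ### Stability of the scheme -/

/-- Characteristics may leave `(0, 1)`, so cells with arbitrary integer index are needed; they
reduce to index `j % M` by a translation through `j / M` periods. -/
theorem dgSpace_eq_eval {k M : ℕ} (hM : 1 ≤ M) (u : dgSpace k M) (j : ℤ) :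
    ∃ p : Polynomial ℝ, p.natDegree ≤ k ∧
      ∀ x ∈ Ioo (j / M : ℝ) ((j + 1) / M), u.1 x = p.eval x := by
  have hM' : (0 : ℝ) < M := by exact_mod_cast hM
  have hMz : (0 : ℤ) < M := by exact_mod_cast hM
  obtain ⟨i, hi⟩ := Int.eq_ofNat_of_zero_le (Int.emod_nonneg j hMz.ne')
  have hiM : i < M := by
    have := Int.emod_lt_of_pos j hMz
    omega
  obtain ⟨p, hp, hpu⟩ := u.2.2.1 i hiM
  have hj : (j : ℝ) = i + (j / M : ℤ) * M := by
    have := Int.emod_add_mul_ediv j M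
    rw [hi] at this
    rw [mul_comm]
    exact_mod_cast this.symm
  refine ⟨p.comp (X - C ((j / M : ℤ) : ℝ)), ?_, fun x hx => ?_⟩
  · refine natDegree_comp_le.trans ?_
    rw [natDegree_X_sub_C, mul_one]
    exact hp
  · have hper := u.2.1.sub_int_mul_eq (j / M : ℤ) (x := x)
    rw [mul_one] at hper
    rw [← hper, hpu, eval_comp, eval_sub, eval_X, eval_C]
    rw [hj] at hx
    have e1 : ((i : ℝ) + (j / M : ℤ) * M) / M = i / M + (j / M : ℤ) := by field_simp
    have e2 : ((i : ℝ) + (j / M : ℤ) * M + 1) / M = (i + 1) / M + (j / M : ℤ) := by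
      field_simp; ring
    rw [e1, e2] at hx
    exact ⟨by linarith [hx.1], by linarith [hx.2]⟩

theorem GaussRule.quad_congr {k : ℕ} (G : GaussRule k) {a d : ℝ} (had : a < d) {f g : ℝ → ℝ}
    (h : ∀ x ∈ Ioo a d, f x = g x) : G.quad a d f = G.quad a d g := by
  refine Finset.sum_congr rfl fun α _ => ?_
  obtain ⟨h1, h2⟩ := G.node_mem α
  rw [h]
  constructor <;> nlinarith

theorem intervalIntegral_congr_Ioo {a d : ℝ} (had : a ≤ d) {f g : ℝ → ℝ}
    (h : ∀ x ∈ Ioo a d, f x = g x) : ∫ x in a..d, f x = ∫ x in a..d, g x := by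
  rw [intervalIntegral.integral_of_le had, intervalIntegral.integral_of_le had,
    integral_Ioc_eq_integral_Ioo, integral_Ioc_eq_integral_Ioo]
  exact setIntegral_congr_fun measurableSet_Ioo h

theorem intervalIntegrable_sq {k M : ℕ} (u : dgSpace k M) (a d : ℝ) :
    IntervalIntegrable (fun x => u.1 x ^ 2) volume a d := by
  have hper : Function.Periodic (fun x => u.1 x ^ 2) 1 := fun x => by simp only [u.2.1 x]
  refine hper.intervalIntegrable one_ne_zero (t := 0) ?_ a d
  rw [zero_add, intervalIntegrable_iff_integrableOn_Ioo_of_le zero_le_one]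
  simpa only [sq] using integrable_mul u u

/-- The integrals telescope to one over `[f 0, f 0 + 1]`, a full period. It serves for `f = id` and
for the backward flow. -/
theorem sum_integral_cells {k M : ℕ} (hM : 1 ≤ M) (u : dgSpace k M) (b : ℝ → ℝ) (Δt : ℝ)
    {f : ℝ → ℝ} (hf : ∀ x, f (x + 1) = f x + 1) :
    ∑ i ∈ Finset.range M, ∑ q ∈ Finset.range ((breaks b Δt M i).card + 1),
      ∫ x in f (subPt b Δt M i q)..f (subPt b Δt M i (q + 1)), u.1 x ^ 2 =
    ∫ x in (0 : ℝ)..1, u.1 x ^ 2 := by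
  have hM' : (M : ℝ) ≠ 0 := by positivity
  have h1 : ∀ i ∈ Finset.range M, ∑ q ∈ Finset.range ((breaks b Δt M i).card + 1),
      ∫ x in f (subPt b Δt M i q)..f (subPt b Δt M i (q + 1)), u.1 x ^ 2 =
      ∫ x in f ((i : ℕ) / M)..f ((i + 1 : ℕ) / M), u.1 x ^ 2 := fun i _ => by
    rw [intervalIntegral.sum_integral_adjacent_intervals
      (a := fun q => f (subPt b Δt M i q)) fun q _ => intervalIntegrable_sq u _ _]
    simp only [subPt_card_succ, Nat.cast_add, Nat.cast_one]
    rfl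
  rw [Finset.sum_congr rfl h1, intervalIntegral.sum_integral_adjacent_intervals
    (a := fun i : ℕ => f (i / M)) fun q _ => intervalIntegrable_sq u _ _]
  have hper : Function.Periodic (fun x => u.1 x ^ 2) 1 := fun x => by simp only [u.2.1 x]
  have h2 : f (M / M) = f 0 + 1 := by rw [div_self hM', ← hf, zero_add]
  rw [h2, Nat.cast_zero, zero_div, hper.intervalIntegral_add_eq (f 0) 0, zero_add]

/-- The form `(·, ·)_G` is exact on `V_k`. -/
theorem gaussForm_self {k M : ℕ} (G : GaussRule k) (hM : 1 ≤ M) (b : ℝ → ℝ) (Δt : ℝ)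
    (u : dgSpace k M) : gaussForm G b Δt M u.1 u.1 = ∫ x in (0 : ℝ)..1, u.1 x ^ 2 := by
  rw [← sum_integral_cells hM u b Δt (f := id) fun _ => rfl]
  refine Finset.sum_congr rfl fun i _ => Finset.sum_congr rfl fun q hq => ?_
  have hq' : q ≤ (breaks b Δt M i).card := by rw [Finset.mem_range] at hq; omega
  have hlt := subPt_lt_succ hM hq'
  obtain ⟨p, hp, hpu⟩ := dgSpace_eq_eval hM u i
  rw [Int.cast_natCast] at hpu
  have hpu' : ∀ x ∈ Ioo (subPt b Δt M i q) (subPt b Δt M i (q + 1)), u.1 x = p.eval x :=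
    fun x hx => hpu x ⟨(subPt_mem_Icc hM (by omega)).1.trans_lt hx.1,
      hx.2.trans_le (subPt_mem_Icc hM (by omega)).2⟩
  rw [G.quad_congr hlt (g := fun x => (p ^ 2).eval x) fun x hx => by
      rw [hpu' x hx, eval_pow, sq], G.quad_eval _ _ (natDegree_pow_le.trans (by omega))]
  simp only [id]
  refine intervalIntegral_congr_Ioo hlt.le fun x hx => ?_
  simp only [hpu' x hx, eval_pow]

/-- The exponent `c` comes from the reference interval alone, hence is independent of the mesh, the
time step and `b`. -/
theorem exists_gaussForm_charFlow_le {k : ℕ} (G : GaussRule k) :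
    ∃ c : ℕ, ∀ (b : ℝ → ℝ) (K : NNReal), LipschitzWith K b → Function.Periodic b 1 →
      ∀ (M : ℕ) (Δt : ℝ), 1 ≤ M → ∀ u : dgSpace k M,
      gaussForm G b Δt M (fun x => u.1 (charFlow b x (-Δt))) (fun x => u.1 (charFlow b x (-Δt))) ≤
        Real.exp (K * |Δt|) ^ c * ∫ x in (0 : ℝ)..1, u.1 x ^ 2 := by
  obtain ⟨c, hc⟩ := G.exists_quad_comp_le
  refine ⟨c, fun b K hK hper M Δt hM u => ?_⟩
  have hb : ∃ K, LipschitzWith K b := ⟨K, hK⟩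
  set f : ℝ → ℝ := fun x => charFlow b x (-Δt) with hf
  have hmono : StrictMono f := strictMono_charFlow hb hper (-Δt)
  rw [← sum_integral_cells hM u b Δt (f := f) fun x => charFlow_add_one hb hper x (-Δt)]
  rw [gaussForm, Finset.mul_sum]
  refine Finset.sum_le_sum fun i _ => ?_
  rw [Finset.mul_sum]
  refine Finset.sum_le_sum fun q hq => ?_
  have hq' : q ≤ (breaks b Δt M i).card := by rw [Finset.mem_range] at hq; omega
  have hlt := subPt_lt_succ hM hq'
  obtain ⟨j, hj1, hj2⟩ := exists_cell_charFlow hb hper hM hq'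
  obtain ⟨p, hp, hpu⟩ := dgSpace_eq_eval hM u j
  have hpu' : ∀ x ∈ Ioo (f (subPt b Δt M i q)) (f (subPt b Δt M i (q + 1))), u.1 x = p.eval x :=
    fun x hx => hpu x ⟨hj1.trans_lt hx.1, hx.2.trans_le hj2⟩
  rw [G.quad_congr hlt (g := fun x => p.eval (f x) ^ 2) fun x hx => by
      rw [hpu' (f x) ⟨hmono hx.1, hmono hx.2⟩, sq],
    intervalIntegral_congr_Ioo (g := fun x => p.eval x ^ 2) (hmono hlt).le
      fun x hx => by simp only [hpu' x hx]]
  exact hc p hp f _ _ _ hlt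
    (fun x z hxz => by simpa using charFlow_sub_le hK hper (-Δt) hxz)
    (fun x z hxz => by simpa using le_charFlow_sub hK hper (-Δt) hxz)
    hmono (Real.one_le_exp (by positivity))

/-- Test the scheme with its own result and apply `2 * x * y ≤ x² + y²` at each Gauss point, where
the weights are nonnegative; exactness of the form on `w` absorbs the `w` term. -/
theorem integral_sldgOp_sq_le {k M : ℕ} (G : GaussRule k) (hM : 1 ≤ M) (b : ℝ → ℝ) (Δt : ℝ)
    (u : dgSpace k M) :
    ∫ x in (0 : ℝ)..1, (sldgOp G b Δt M u).1 x ^ 2 ≤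
      gaussForm G b Δt M (fun x => u.1 (charFlow b x (-Δt)))
        (fun x => u.1 (charFlow b x (-Δt))) := by
  set w := sldgOp G b Δt M u
  set f := fun x => u.1 (charFlow b x (-Δt))
  have h1 : ∫ x in (0 : ℝ)..1, w.1 x ^ 2 = gaussForm G b Δt M f w.1 := by
    rw [← sldgOp_spec G b Δt M u w, intervalIntegral.integral_of_le zero_le_one,
      integral_Ioc_eq_integral_Ioo]
    simp only [sq]; rfl
  have h2 := gaussForm_self G hM b Δt w
  have h3 : 2 * gaussForm G b Δt M f w.1 ≤
      gaussForm G b Δt M f f + gaussForm G b Δt M w.1 w.1 := by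
    simp only [gaussForm, GaussRule.quad, Finset.mul_sum]
    rw [← Finset.sum_add_distrib]
    refine Finset.sum_le_sum fun i _ => ?_
    rw [← Finset.sum_add_distrib]
    refine Finset.sum_le_sum fun q hq => ?_
    rw [← Finset.sum_add_distrib]
    refine Finset.sum_le_sum fun α _ => ?_
    have hlt := subPt_lt_succ (b := b) (Δt := Δt) (i := i) hM
      (q := q) (by rw [Finset.mem_range] at hq; omega)
    have hpos := mul_nonneg (div_nonneg (G.weight_pos α).le zero_le_two) (sub_nonneg.mpr hlt.le)
    rw [← mul_add, mul_left_comm]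
    refine mul_le_mul_of_nonneg_left ?_ hpos
    have := two_mul_le_add_sq
      (f (subPt b Δt M i q + 1 / 2 * (1 + G.node α) * (subPt b Δt M i (q + 1) - subPt b Δt M i q)))
      (w.1 (subPt b Δt M i q + 1 / 2 * (1 + G.node α) *
        (subPt b Δt M i (q + 1) - subPt b Δt M i q)))
    linarith
  linarith

theorem memLp_dgSpace {k M : ℕ} (u : dgSpace k M) :
    MemLp u.1 2 (volume.restrict (Ioo (0 : ℝ) 1)) := by
  have hmeas : MeasurableSet (⋃ i : Fin M, cell M i) :=
    MeasurableSet.iUnion fun _ => measurableSet_Ioo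
  have h1 : AEStronglyMeasurable u.1 (volume.restrict (⋃ i : Fin M, cell M i)) := by
    rw [aestronglyMeasurable_iUnion_iff]
    intro i
    obtain ⟨p, -, hp⟩ := u.2.2.1 i i.2
    refine p.continuous.aestronglyMeasurable.congr ?_
    filter_upwards [ae_restrict_mem measurableSet_Ioo] with x hx
    exact (hp x hx).symm
  have h2 : AEStronglyMeasurable u.1 (volume.restrict (Ioo (0 : ℝ) 1 \ ⋃ i : Fin M, cell M i)) := by
    refine (aestronglyMeasurable_const (b := (0 : ℝ))).congr ?_
    filter_upwards [ae_restrict_mem (measurableSet_Ioo.diff hmeas)] with x hx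
    exact (u.2.2.2 x (Ioo_subset_Ico_self hx.1) fun i hi hxi =>
      hx.2 (mem_iUnion.mpr ⟨⟨i, hi⟩, hxi⟩)).symm
  have h3 := (aestronglyMeasurable_union_iff.mpr ⟨h1, h2⟩).mono_set (s := Ioo (0 : ℝ) 1)
    (by rw [union_sdiff_self]; exact subset_union_right)
  exact (memLp_two_iff_integrable_sq h3).mpr (by simpa only [sq, IntegrableOn] using integrable_mul u u)

theorem l2norm_sq {k M : ℕ} (u : dgSpace k M) :
    l2norm u.1 ^ 2 = ∫ x in (0 : ℝ)..1, u.1 x ^ 2 := by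
  have h0 : 0 ≤ ∫ x in Ioo (0 : ℝ) 1, ‖u.1 x‖ ^ (2 : ENNReal).toReal :=
    integral_nonneg fun x => by positivity
  rw [l2norm, (memLp_dgSpace u).eLpNorm_eq_integral_rpow_norm two_ne_zero ENNReal.ofNat_ne_top,
    ENNReal.toReal_ofReal (by positivity), ← Real.rpow_natCast, ← Real.rpow_mul h0,
    intervalIntegral.integral_of_le zero_le_one, integral_Ioc_eq_integral_Ioo]
  simp

theorem exists_l2norm_sldgOp_le {k : ℕ} (G : GaussRule k) {b : ℝ → ℝ} {K : NNReal}
    (hK : LipschitzWith K b) (hper : Function.Periodic b 1) :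
    ∃ C₁ : ℝ, 0 ≤ C₁ ∧ ∀ M : ℕ, 1 ≤ M → ∀ Δt : ℝ, 0 < Δt → ∀ u : dgSpace k M,
      l2norm (sldgOp G b Δt M u) ≤ Real.exp (C₁ * Δt) * l2norm u := by
  obtain ⟨c, hc⟩ := exists_gaussForm_charFlow_le G
  -- Half the exponent of the squared estimate.
  refine ⟨c * K / 2, by positivity, fun M hM Δt hΔ u => ?_⟩
  have h0 : 0 ≤ l2norm u.1 := ENNReal.toReal_nonneg
  refine (abs_le_of_sq_le_sq' ?_ (mul_nonneg (Real.exp_pos _).le h0)).2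
  rw [mul_pow, l2norm_sq, l2norm_sq]
  refine (integral_sldgOp_sq_le G hM b Δt u).trans
    ((hc b K hK hper M Δt hM u).trans_eq ?_)
  rw [← Real.exp_nat_mul, ← Real.exp_nat_mul, abs_of_pos hΔ]
  congr 2
  push_cast
  ring

end SLDG

theorem mainTheorem2 (k : ℕ) (G : SLDG.GaussRule k) (b : ℝ → ℝ)
    (hlip : ∃ K, LipschitzWith K b) (hper : Function.Periodic b 1) :
    (∀ u : ℝ → ℝ, Function.Periodic u 1 →
      MeasureTheory.MemLp u 2 (MeasureTheory.volume.restrict (Set.Ioo (0 : ℝ) 1)) →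
      ∀ t : ℝ,
        MeasureTheory.MemLp (fun x => u (SLDG.charFlow b x (-t))) 2
          (MeasureTheory.volume.restrict (Set.Ioo (0 : ℝ) 1)) ∧
        SLDG.l2norm (fun x => u (SLDG.charFlow b x (-t))) ≤
          Real.exp (1 / 2 * SLDG.derivBound b * |t|) * SLDG.l2norm u) ∧
    (ContDiff ℝ ((2 * k + 2 : ℕ) : WithTop ℕ∞) b →
      ∃ C₁ : ℝ, 0 ≤ C₁ ∧ ∀ M : ℕ, 1 ≤ M → ∀ Δt : ℝ, 0 < Δt →
        (∀ u : SLDG.dgSpace k M,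
          SLDG.l2norm (SLDG.sldgOp G b Δt M u) ≤ Real.exp (C₁ * Δt) * SLDG.l2norm u) ∧
        (∀ u : ℕ → SLDG.dgSpace k M, (∀ n, u (n + 1) = SLDG.sldgOp G b Δt M (u n)) →
          ∀ n : ℕ, SLDG.l2norm (u n) ≤ Real.exp (C₁ * (n * Δt)) * SLDG.l2norm (u 0))) := by
  have hK := SLDG.lipschitzWith_derivBound hlip hper
  refine ⟨fun u hu hmem t => ?_, fun _ => ?_⟩
  · have h := SLDG.transport_L2 hK hper hu hmem (-t)
    rwa [abs_neg, Real.coe_toNNReal (SLDG.derivBound b) ENNReal.toReal_nonneg] at h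
  · obtain ⟨C₁, hC, hstep⟩ := SLDG.exists_l2norm_sldgOp_le G hK hper
    refine ⟨C₁, hC, fun M hM Δt hΔ => ⟨hstep M hM Δt hΔ, fun u hu n => ?_⟩⟩
    induction n with
    | zero => simp
    | succ n ih =>
      rw [hu n]
      refine (hstep M hM Δt hΔ (u n)).trans
        ((mul_le_mul_of_nonneg_left ih (Real.exp_pos _).le).trans_eq ?_)
      rw [← mul_assoc, ← Real.exp_add]
      congr 2
      push_cast
      ring
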